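/- Let $X$ be a locally compact Hausdorff space, let $2^X$ be the set of all closed subsets of $X$ (including $\emptyset$), and let $\mathsf F$ be the Fell topology on $2^X$, i.e. the topology generated by the sets $\{F\in 2^X : F\cap U\neq\emptyset\}$ with $U\subset X$ open and $\{F\in 2^X : F\cap K=\emptyset\}$ with $K\subset X$ compact. Then the following are equivalent: (a) $(2^X,\mathsf F)$ has countable tightness; (b) $(2^X,\mathsf F)$ has the Reznichenko property; (c) $(2^X,\mathsf F)$ has the Pytkeev property; (d) $X$ is hereditarily separable and hereditarily Lindelöf, i.e. every subspace of $X$ is separable and every subspace of $X$ is Lindelöf. Here a space $Y$ has *countable tightness* if for all $A\subset Y$ and $y\in\overline{A}$ there is a countable $B\subset A$ with $y\in\overline{B}$. It has the *Reznichenko property* if for all $A\subset Y$ and $y\in\overline{A}\setminus A$ there is a countably infinite family $\mathcal A$ of pairwise disjoint finite subsets of $A$ such that each neighbourhood of $y$ meets all but finitely many members of $\mathcal A$. It has the *Pytkeev property* if for all $A\subset Y$ and $y\in\overline{A\setminus\{y\}}$ there are countably infinite sets $A_n\subset A$, $n\in\mathbb N$, such that each neighbourhood of $y$ contains some $A_n$.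 -/

import Mathlib

open Set Filter Topology TopologicalSpace

/-- Countable tightness: a point in the closure of `A` lies in the closure of a countable
subset of `A`. -/
def HasCountableTightness (Y : Type*) [TopologicalSpace Y] : Prop :=
  ∀ (A : Set Y) (y : Y), y ∈ closure A → ∃ B : Set Y, B ⊆ A ∧ B.Countable ∧ y ∈ closure B

/-- The Reznichenko property: for `y ∈ closure A \ A` there is a countably infinite family of
pairwise disjoint finite subsets of `A` such that every neighbourhood of `y` meets all but
finitely many members of the family. -/
def HasReznichenkoProperty (Y : Type*) [TopologicalSpace Y] : Prop :=
  ∀ (A : Set Y) (y : Y), y ∈ closure A \ A →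
    ∃ 𝒜 : Set (Set Y), 𝒜.Countable ∧ 𝒜.Infinite ∧
      (∀ B ∈ 𝒜, B.Finite ∧ B ⊆ A) ∧
      (∀ B ∈ 𝒜, ∀ C ∈ 𝒜, B ≠ C → Disjoint B C) ∧
      ∀ U ∈ 𝓝 y, {B ∈ 𝒜 | ¬ (B ∩ U).Nonempty}.Finite

/-- The Pytkeev property: for `y ∈ closure (A \ {y})` there is a sequence of countably infinite
subsets of `A` that is a `π`-network at `y`. -/
def HasPytkeevProperty (Y : Type*) [TopologicalSpace Y] : Prop :=
  ∀ (A : Set Y) (y : Y), y ∈ closure (A \ {y}) →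
    ∃ B : ℕ → Set Y, (∀ n, B n ⊆ A ∧ (B n).Countable ∧ (B n).Infinite) ∧
      ∀ U ∈ 𝓝 y, ∃ n, B n ⊆ U

/-- Every subspace of `X` is separable. -/
def IsHereditarilySeparableSpace (X : Type*) [TopologicalSpace X] : Prop :=
  ∀ s : Set X, SeparableSpace s

/-- The lower Vietoris topology on the closed subsets of `X`, generated by the sets
`{F | F ∩ U ≠ ∅}` with `U` open. -/
abbrev lowerVietoris (X : Type*) [TopologicalSpace X] : TopologicalSpace (Closeds X) :=
  generateFrom {S | ∃ U : Set X, IsOpen U ∧ S = {F : Closeds X | ((F : Set X) ∩ U).Nonempty}}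

/-- The upper Fell (co-compact) topology on the closed subsets of `X`, generated by the sets
`{F | F ⊆ Kᶜ}` with `K` compact. -/
abbrev upperFell (X : Type*) [TopologicalSpace X] : TopologicalSpace (Closeds X) :=
  generateFrom {S | ∃ K : Set X, IsCompact K ∧ S = {F : Closeds X | (F : Set X) ⊆ Kᶜ}}

/-- The set `2^X` of all closed subsets of `X` (including the empty set), to be equipped with
the Fell topology. -/
def FellHyperspace (X : Type*) [TopologicalSpace X] : Type _ := Closeds X

/-- The Fell topology: the coarsest topology finer than both the lower Vietoris and the upper
Fell topology (in Mathlib's order on topologies this is the infimum). -/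
instance FellHyperspace.instTopologicalSpace (X : Type*) [TopologicalSpace X] :
    TopologicalSpace (FellHyperspace X) :=
  (lowerVietoris X ⊓ upperFell X : TopologicalSpace (Closeds X))

/-!
Every monotone net of closed sets converges in the Fell topology to the closure of its union, and
every antitone net to its intersection. Countable tightness, applied to the net of closures of
finite subsets of `S ⊆ X`, yields a countable dense subset of `S`; applied to the net of complements
of finite subunions of an open cover of `S`, it yields a countable subcover. Conversely, if `X` is
locally compact and hereditarily Lindelöf, then all its open sets are hemicompact. A compact
neighbourhood of `x`, minus the closures of compact sets exhausting the complement of the closure of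
`{x}`, gives a countable base at `x`. A countable dense subset of a closed set `F`, with countable
bases at its points, then controls the sets `U` in the conditions `F ∩ U ≠ ∅`, and hemicompactness
of `Fᶜ` controls the sets `K` in the conditions `F ∩ K = ∅`. So the hyperspace is first countable,
and being T₁ it has the Pytkeev property. Finally, from infinite sets `B n` as in the Pytkeev
property one picks pairwise disjoint finite sets `D n` meeting each of `B 0, …, B n`; these form a
Reznichenko family, and the union of such a family witnesses countable tightness.
-/

section CountableChoice

variable {α ι : Type*}

theorem exists_finset_disjoint_and_inter_nonempty {B : ι → Set α} (hB : ∀ i, (B i).Infinite)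
    (s : Finset ι) (E : Finset α) :
    ∃ C : Finset α, ↑C ⊆ ⋃ i, B i ∧ Disjoint E C ∧ ∀ i ∈ s, ((C : Set α) ∩ B i).Nonempty := by
  classical
  choose x hxB hxE using fun i ↦ (hB i).exists_notMem_finset E
  refine ⟨s.image x, ?_, ?_, fun i hi ↦ ⟨x i, Finset.mem_image_of_mem x hi, hxB i⟩⟩
  · rw [Finset.coe_image]
    exact image_subset_iff.2 fun i _ ↦ mem_iUnion_of_mem i (hxB i)
  · rw [Finset.disjoint_right]
    exact Finset.forall_mem_image.2 fun i _ ↦ hxE i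

theorem exists_seq_pairwise_disjoint_finset_and_inter_nonempty {B : ℕ → Set α}
    (hB : ∀ n, (B n).Infinite) :
    ∃ D : ℕ → Finset α, Pairwise (Function.onFun Disjoint D) ∧
      ∀ n, ↑(D n) ⊆ ⋃ i, B i ∧ ∀ i ≤ n, ((D n : Set α) ∩ B i).Nonempty := by
  classical
  -- Each set carries the number of `B i` it has to meet, which increases along the sequence.
  obtain ⟨p, hp, hpp⟩ := exists_seq_of_forall_finset_exists
    (fun q : ℕ × Finset α ↦ ↑q.2 ⊆ ⋃ i, B i ∧ ∀ i ≤ q.1, ((q.2 : Set α) ∩ B i).Nonempty)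
    (fun q r ↦ q.1 < r.1 ∧ Disjoint q.2 r.2) fun s _ ↦ by
      obtain ⟨C, hCB, hC, hCne⟩ := exists_finset_disjoint_and_inter_nonempty hB
        (Finset.Iic (s.sup Prod.fst + 1)) (s.biUnion Prod.snd)
      exact ⟨(s.sup Prod.fst + 1, C), ⟨hCB, fun i hi ↦ hCne i (Finset.mem_Iic.2 hi)⟩,
        fun q hq ↦ ⟨Nat.lt_succ_of_le (Finset.le_sup (f := Prod.fst) hq),
          hC.mono_left (Finset.subset_biUnion_of_mem Prod.snd hq)⟩⟩
  have hmono : StrictMono fun n ↦ (p n).1 := fun m n hmn ↦ (hpp m n hmn).1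
  refine ⟨fun n ↦ (p n).2, fun m n hmn ↦ ?_, fun n ↦
    ⟨(hp n).1, fun i hi ↦ (hp n).2 i (hi.trans hmono.le_apply)⟩⟩
  exact hmn.lt_or_gt.elim (fun h ↦ (hpp m n h).2) fun h ↦ (hpp n m h).2.symm

end CountableChoice

section CountabilityProperties

variable {Y : Type*} [TopologicalSpace Y]

theorem HasPytkeevProperty.hasReznichenkoProperty (h : HasPytkeevProperty Y) :
    HasReznichenkoProperty Y := by
  rintro A y ⟨hy, hyA⟩
  obtain ⟨B, hB, hBU⟩ := h A y (by rwa [sdiff_singleton_eq_self hyA])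
  obtain ⟨D, hDdisj, hD⟩ :=
    exists_seq_pairwise_disjoint_finset_and_inter_nonempty fun n ↦ (hB n).2.2
  have hDne (n : ℕ) : (D n : Set Y).Nonempty := ((hD n).2 n le_rfl).mono inter_subset_left
  have hdisj : Pairwise fun m n ↦ Disjoint (D m : Set Y) (D n) := fun m n hmn ↦
    Finset.disjoint_coe.2 (hDdisj hmn)
  have hinj : Function.Injective fun n ↦ (D n : Set Y) := fun m n hmn ↦ by
    by_contra hne
    obtain ⟨x, hx⟩ := hDne m
    exact (hdisj hne).ne_of_mem hx ((Set.ext_iff.1 hmn x).1 hx) rfl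
  refine ⟨range fun n ↦ (D n : Set Y), countable_range _, infinite_range_of_injective hinj,
    forall_mem_range.2 fun n ↦ ⟨(D n).finite_toSet,
      (hD n).1.trans (iUnion_subset fun i ↦ (hB i).1)⟩,
    fun _ hB _ hC hne ↦ hdisj.range_pairwise hB hC hne, fun U hU ↦ ?_⟩
  obtain ⟨n, hn⟩ := hBU U hU
  refine ((finite_Iio n).image fun n ↦ (D n : Set Y)).subset ?_
  rintro _ ⟨⟨m, rfl⟩, hm⟩
  refine ⟨m, mem_Iio.2 <| not_le.1 fun hnm ↦ hm ?_, rfl⟩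
  exact ((hD m).2 n hnm).mono (inter_subset_inter_right _ hn)

theorem HasReznichenkoProperty.hasCountableTightness (h : HasReznichenkoProperty Y) :
    HasCountableTightness Y := by
  intro A y hy
  by_cases hyA : y ∈ A
  · exact ⟨{y}, singleton_subset_iff.2 hyA, countable_singleton y, subset_closure rfl⟩
  obtain ⟨𝒜, hcountable, hinfinite, h𝒜, -, hmeet⟩ := h A y ⟨hy, hyA⟩
  refine ⟨⋃₀ 𝒜, sUnion_subset fun B hB ↦ (h𝒜 B hB).2,
    hcountable.sUnion fun B hB ↦ (h𝒜 B hB).1.countable, mem_closure_iff_nhds.2 fun U hU ↦ ?_⟩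
  obtain ⟨B, hB, hBU⟩ := (hinfinite.sdiff (hmeet U hU)).nonempty
  obtain ⟨x, hxB, hxU⟩ : (B ∩ U).Nonempty := by_contra fun hne ↦ hBU ⟨hB, hne⟩
  exact ⟨x, hxU, B, hB, hxB⟩

theorem hasPytkeevProperty_of_firstCountableTopology [T1Space Y] [FirstCountableTopology Y] :
    HasPytkeevProperty Y := by
  intro A y hy
  have hacc : AccPt y (𝓟 A) :=
    accPt_principal_iff_clusterPt.2 (mem_closure_iff_clusterPt.1 hy)
  obtain ⟨V, hV⟩ := (𝓝 y).exists_antitone_basis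
  have hinf (n : ℕ) : (V n ∩ A).Infinite := .of_accPt (hacc.nhds_inter (hV.mem n))
  choose B hB hBcountable hBinf using fun n ↦ (hinf n).exists_subset_countable_infinite
  refine ⟨B, fun n ↦ ⟨(hB n).trans inter_subset_right, hBcountable n, hBinf n⟩, fun U hU ↦ ?_⟩
  obtain ⟨n, hn⟩ := hV.mem_iff.1 hU
  exact ⟨n, (hB n).trans (inter_subset_left.trans hn)⟩

theorem HasCountableTightness.exists_countable_mem_closure_image (h : HasCountableTightness Y)
    {ι : Type*} {l : Filter ι} [l.NeBot] {f : ι → Y} {y : Y} (hf : Tendsto f l (𝓝 y)) :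
    ∃ C : Set ι, C.Countable ∧ y ∈ closure (f '' C) := by
  obtain ⟨B, hBf, hBcountable, hyB⟩ := h (range f) y
    (mem_closure_of_tendsto hf (.of_forall mem_range_self))
  obtain ⟨C, rfl, hinj⟩ := exists_image_eq_injOn_of_subset_range hBf
  exact ⟨C, countable_of_injective_of_countable_image hinj hBcountable, hyB⟩

end CountabilityProperties

section CountableFamilies

variable {X : Type*} [TopologicalSpace X]

/-- A set `S` is hemicompact if countably many of its compact subsets are cofinal, with respect to
inclusion, among all of its compact subsets. -/
def IsHemicompact (S : Set X) : Prop :=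
  ∃ K : ℕ → Set X, (∀ n, IsCompact (K n) ∧ K n ⊆ S) ∧ ∀ C, IsCompact C → C ⊆ S → ∃ n, C ⊆ K n

/-- A set `S` has a countable outer `π`-base if there is a countable family of open sets of the
ambient space, all meeting `S`, such that every open set meeting `S` contains a member of the
family. It is the counterpart of hemicompactness for the lower half of the Fell topology. -/
def HasCountableOuterPiBase (S : Set X) : Prop :=
  ∃ 𝒱 : Set (Set X), 𝒱.Countable ∧ (∀ V ∈ 𝒱, IsOpen V ∧ (S ∩ V).Nonempty) ∧
    ∀ U, IsOpen U → (S ∩ U).Nonempty → ∃ V ∈ 𝒱, V ⊆ U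

theorem sigmaCompactSpace_of_weaklyLocallyCompact_of_lindelof [WeaklyLocallyCompactSpace X]
    [LindelofSpace X] : SigmaCompactSpace X := by
  choose N hN hNx using fun x : X ↦ exists_compact_mem_nhds x
  obtain ⟨t, ht, htN⟩ := LindelofSpace.elim_nhds_subcover N hNx
  exact .of_countable (N '' t) (ht.image N) (forall_mem_image.2 fun x _ ↦ hN x)
    (by rwa [sUnion_image])

theorem isHemicompact_of_weaklyLocallyCompact_of_lindelof (S : Set X)
    [WeaklyLocallyCompactSpace S] [LindelofSpace S] : IsHemicompact S := by
  have : SigmaCompactSpace S := sigmaCompactSpace_of_weaklyLocallyCompact_of_lindelof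
  let K := CompactExhaustion.choice S
  refine ⟨fun n ↦ Subtype.val '' K n, fun n ↦ ⟨(K.isCompact n).image continuous_subtype_val,
    Subtype.coe_image_subset _ _⟩, fun C hC hCS ↦ ?_⟩
  have hC' : IsCompact (Subtype.val ⁻¹' C : Set S) :=
    (IsInducing.subtypeVal.isCompact_preimage_iff (by simpa using hCS)).2 hC
  obtain ⟨n, hn⟩ := K.exists_superset_of_isCompact hC'
  exact ⟨n, fun x hx ↦ ⟨⟨x, hCS hx⟩, hn hx, rfl⟩⟩

theorem IsHemicompact.isCountablyGenerated_nhds [R1Space X] [WeaklyLocallyCompactSpace X] {x : X}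
    (hx : IsHemicompact (closure {x})ᶜ) : (𝓝 x).IsCountablyGenerated := by
  obtain ⟨L, hL, hLx⟩ := exists_compact_mem_nhds x
  obtain ⟨K, hK, hKcofinal⟩ := hx
  have hclosure (n : ℕ) : x ∉ closure (K n) := fun hxK ↦
    (hK n).1.closure_subset_of_isOpen isClosed_closure.isOpen_compl (hK n).2 hxK
      (subset_closure rfl)
  have hbasis : (𝓝 x).HasBasis (fun _ : ℕ ↦ True) fun n ↦ L \ closure (K n) := by
    refine ⟨fun U ↦ ⟨fun hU ↦ ?_, fun ⟨n, _, hn⟩ ↦ mem_of_superset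
      (inter_mem hLx (isClosed_closure.isOpen_compl.mem_nhds (hclosure n))) hn⟩⟩
    have hdisj : L \ interior U ⊆ (closure {x})ᶜ := fun z hz hzx ↦
      hz.2 ((specializes_iff_mem_closure.2 hzx).symm.mem_open isOpen_interior
        (mem_interior_iff_mem_nhds.2 hU))
    obtain ⟨n, hn⟩ := hKcofinal _ (hL.diff isOpen_interior) hdisj
    refine ⟨n, trivial, fun z hz ↦ by_contra fun hzU ↦ hz.2 (subset_closure (hn ⟨hz.1, ?_⟩))⟩
    exact notMem_subset interior_subset hzU
  exact hbasis.isCountablyGenerated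

theorem hasCountableOuterPiBase_of_separableSpace [FirstCountableTopology X] (S : Set X)
    [SeparableSpace S] : HasCountableOuterPiBase S := by
  obtain ⟨D, hD, hDdense⟩ := exists_countable_dense S
  choose V hV using fun x : X ↦ (𝓝 x).exists_antitone_basis
  refine ⟨⋃ d ∈ D, range fun n ↦ interior (V d n), hD.biUnion fun d _ ↦ countable_range _, ?_,
    fun U hU ⟨x, hxS, hxU⟩ ↦ ?_⟩
  · simp only [mem_iUnion₂, mem_range]
    rintro _ ⟨d, -, n, rfl⟩
    exact ⟨isOpen_interior, d, d.2, mem_interior_iff_mem_nhds.2 ((hV d).mem n)⟩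
  · obtain ⟨d, hdU, hdD⟩ := hDdense.inter_open_nonempty (Subtype.val ⁻¹' U)
      (hU.preimage continuous_subtype_val) ⟨⟨x, hxS⟩, hxU⟩
    obtain ⟨n, hn⟩ := (hV d).mem_iff.1 (hU.mem_nhds hdU)
    exact ⟨_, mem_biUnion hdD ⟨n, rfl⟩, interior_subset.trans hn⟩

variable [HereditarilyLindelofSpace X]

theorem isHemicompact_of_isOpen [LocallyCompactSpace X] {U : Set X} (hU : IsOpen U) :
    IsHemicompact U := by
  have := hU.locallyCompactSpace
  exact isHemicompact_of_weaklyLocallyCompact_of_lindelof U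

theorem firstCountableTopology_of_hereditarilyLindelofSpace [R1Space X] [LocallyCompactSpace X] :
    FirstCountableTopology X :=
  ⟨fun _ ↦ (isHemicompact_of_isOpen isClosed_closure.isOpen_compl).isCountablyGenerated_nhds⟩

end CountableFamilies

namespace FellHyperspace

variable {X : Type*} [TopologicalSpace X]

instance instSetLike : SetLike (FellHyperspace X) X :=
  inferInstanceAs (SetLike (Closeds X) X)

/-- A closed set, regarded as a point of the Fell hyperspace. -/
def ofIsClosed {s : Set X} (hs : IsClosed s) : FellHyperspace X := (⟨s, hs⟩ : Closeds X)

@[simp]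
theorem coe_ofIsClosed {s : Set X} (hs : IsClosed s) : (ofIsClosed hs : Set X) = s := rfl

theorem isClosed (F : FellHyperspace X) : IsClosed (F : Set X) := Closeds.isClosed F

/-- The subbasic open set `U⁻` of the lower Vietoris topology: the closed sets meeting `U`. -/
def hit (U : Set X) : Set (FellHyperspace X) := {F | ((F : Set X) ∩ U).Nonempty}

/-- The subbasic open set `(Kᶜ)⁺` of the upper Fell topology: the closed sets disjoint from `K`. -/
def miss (K : Set X) : Set (FellHyperspace X) := {F | (F : Set X) ⊆ Kᶜ}

@[simp]
theorem mem_hit {U : Set X} {F : FellHyperspace X} : F ∈ hit U ↔ ((F : Set X) ∩ U).Nonempty := .rfl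

@[simp]
theorem mem_miss {K : Set X} {F : FellHyperspace X} : F ∈ miss K ↔ (F : Set X) ⊆ Kᶜ := .rfl

theorem hit_mono {U V : Set X} (h : U ⊆ V) : hit U ⊆ hit V :=
  fun _ hF ↦ hF.mono (inter_subset_inter_right _ h)

theorem miss_anti {K L : Set X} (h : K ⊆ L) : miss L ⊆ miss K :=
  fun _ hF ↦ hF.trans (compl_subset_compl.2 h)

theorem isOpen_hit {U : Set X} (hU : IsOpen U) : IsOpen (hit U) :=
  (inf_le_left : lowerVietoris X ⊓ upperFell X ≤ lowerVietoris X) _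
    (isOpen_generateFrom_of_mem ⟨U, hU, rfl⟩)

theorem isOpen_miss {K : Set X} (hK : IsCompact K) : IsOpen (miss K) :=
  (inf_le_right : lowerVietoris X ⊓ upperFell X ≤ upperFell X) _
    (isOpen_generateFrom_of_mem ⟨K, hK, rfl⟩)

theorem tendsto_nhds_of_eventually_hit_of_eventually_miss {ι : Type*} {l : Filter ι}
    {f : ι → FellHyperspace X} {F : FellHyperspace X}
    (hhit : ∀ U, IsOpen U → F ∈ hit U → ∀ᶠ i in l, f i ∈ hit U)
    (hmiss : ∀ K, IsCompact K → F ∈ miss K → ∀ᶠ i in l, f i ∈ miss K) :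
    Tendsto f l (𝓝 F) := by
  have hnhds : 𝓝 F = @nhds (Closeds X) (lowerVietoris X) F ⊓ @nhds (Closeds X) (upperFell X) F :=
    nhds_inf (α := Closeds X)
  rw [hnhds]
  refine tendsto_inf.2 ⟨tendsto_nhds_generateFrom_iff.2 ?_, tendsto_nhds_generateFrom_iff.2 ?_⟩
  · rintro _ ⟨U, hU, rfl⟩ hF
    exact hhit U hU hF
  · rintro _ ⟨K, hK, rfl⟩ hF
    exact hmiss K hK hF

instance instT1Space : T1Space (FellHyperspace X) := by
  refine t1Space_iff_exists_open.2 fun F G hFG ↦ ?_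
  by_cases hle : (F : Set X) ⊆ G
  · obtain ⟨x, hxG, hxF⟩ := not_subset.1 fun h ↦ hFG (SetLike.coe_injective (hle.antisymm h))
    exact ⟨miss {x}, isOpen_miss isCompact_singleton, by simpa using hxF, by simpa using hxG⟩
  · exact ⟨hit (G : Set X)ᶜ, isOpen_hit G.isClosed.isOpen_compl, inter_compl_nonempty_iff.2 hle,
      by simp⟩

section MonotoneNets

variable {ι : Type*} [Preorder ι] {f : ι → FellHyperspace X} {F : FellHyperspace X}

theorem tendsto_of_monotone (hf : Monotone fun i ↦ (f i : Set X))
    (hF : (F : Set X) = closure (⋃ i, f i)) : Tendsto f atTop (𝓝 F) := by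
  refine tendsto_nhds_of_eventually_hit_of_eventually_miss (fun U hU hFU ↦ ?_) fun K _ hFK ↦ ?_
  · rw [mem_hit, hF, closure_inter_open_nonempty_iff hU, iUnion_inter, nonempty_iUnion] at hFU
    obtain ⟨i, hi⟩ := hFU
    filter_upwards [eventually_ge_atTop i] with j hij
    exact hi.mono (inter_subset_inter_left _ (hf hij))
  · rw [mem_miss, hF] at hFK
    exact .of_forall fun i ↦ (subset_iUnion (fun i ↦ (f i : Set X)) i).trans
      (subset_closure.trans hFK)

theorem tendsto_of_antitone (hf : Antitone fun i ↦ (f i : Set X))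
    (hF : (F : Set X) = ⋂ i, f i) : Tendsto f atTop (𝓝 F) := by
  refine tendsto_nhds_of_eventually_hit_of_eventually_miss (fun U _ hFU ↦ ?_) fun K hK hFK ↦ ?_
  · rw [mem_hit, hF] at hFU
    exact .of_forall fun i ↦ hFU.mono (inter_subset_inter_left _ (iInter_subset _ i))
  · rw [mem_miss, hF, subset_compl_iff_disjoint_left, disjoint_iff_inter_eq_empty] at hFK
    obtain ⟨t, ht⟩ := hK.elim_finite_subfamily_closed _ (fun i ↦ (f i).isClosed) hFK
    filter_upwards [(Filter.eventually_all_finset t).2 fun i _ ↦ eventually_ge_atTop i] with j hj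
    rw [mem_miss, subset_compl_iff_disjoint_left, disjoint_iff_inter_eq_empty]
    have hsub : (f j : Set X) ⊆ ⋂ i ∈ t, f i := subset_iInter₂ fun i hi ↦ hf (hj i hi)
    exact subset_empty_iff.1 (ht ▸ inter_subset_inter_right K hsub)

end MonotoneNets

theorem tendsto_closure_finset (S : Set X) :
    Tendsto (fun t : Finset S ↦ ofIsClosed (isClosed_closure (s := Subtype.val '' (t : Set S))))
      atTop (𝓝 (ofIsClosed (isClosed_closure (s := S)))) := by
  refine tendsto_of_monotone (fun s t hst ↦ closure_mono (image_mono hst)) ?_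
  refine subset_antisymm (closure_mono fun x hx ↦ mem_iUnion_of_mem {⟨x, hx⟩} ?_)
    (closure_minimal (iUnion_subset fun t ↦ closure_mono (Subtype.coe_image_subset S t))
      isClosed_closure)
  exact subset_closure ⟨⟨x, hx⟩, Finset.mem_singleton_self _, rfl⟩

theorem tendsto_compl_biUnion_finset {ι : Type*} {U : ι → Set X} (hU : ∀ i, IsOpen (U i)) :
    Tendsto
      (fun t : Finset ι ↦ ofIsClosed (isOpen_biUnion fun i (_ : i ∈ t) ↦ hU i).isClosed_compl)
      atTop (𝓝 (ofIsClosed (isOpen_iUnion hU).isClosed_compl)) := by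
  refine tendsto_of_antitone
    (fun s t hst ↦ compl_subset_compl.2 (biUnion_subset_biUnion_left hst)) ?_
  simp only [coe_ofIsClosed]
  rw [iUnion_eq_iUnion_finset, compl_iUnion]
  rfl

theorem isCountablyGenerated_nhds {F : FellHyperspace X}
    (hF : HasCountableOuterPiBase (F : Set X)) (hFc : IsHemicompact (F : Set X)ᶜ) :
    (𝓝 F).IsCountablyGenerated := by
  obtain ⟨𝒱, h𝒱, h𝒱F, h𝒱cofinal⟩ := hF
  obtain ⟨K, hK, hKcofinal⟩ := hFc
  refine ⟨hit '' 𝒱 ∪ range fun n ↦ miss (K n), (h𝒱.image hit).union (countable_range _),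
    le_antisymm (le_generate_iff.2 (union_subset ?_ ?_)) (tendsto_id'.1 ?_)⟩
  · exact image_subset_iff.2 fun V hV ↦ (isOpen_hit (h𝒱F V hV).1).mem_nhds (h𝒱F V hV).2
  · exact range_subset_iff.2 fun n ↦
      (isOpen_miss (hK n).1).mem_nhds (subset_compl_comm.1 (hK n).2)
  refine tendsto_nhds_of_eventually_hit_of_eventually_miss (fun U hU hFU ↦ ?_) fun C hC hFC ↦ ?_
  · obtain ⟨V, hV, hVU⟩ := h𝒱cofinal U hU hFU
    exact mem_of_superset (mem_generate_of_mem (.inl (mem_image_of_mem hit hV))) (hit_mono hVU)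
  · obtain ⟨n, hn⟩ := hKcofinal C hC (subset_compl_comm.1 hFC)
    exact mem_of_superset (mem_generate_of_mem (.inr (mem_range_self n))) (miss_anti hn)

end FellHyperspace

section FellCountability

variable {X : Type*} [TopologicalSpace X]

open FellHyperspace

theorem HasCountableTightness.isHereditarilySeparableSpace
    (h : HasCountableTightness (FellHyperspace X)) : IsHereditarilySeparableSpace X := by
  intro S
  obtain ⟨C, hC, hSC⟩ := h.exists_countable_mem_closure_image (tendsto_closure_finset S)
  refine ⟨⋃ t ∈ C, (t : Set S), hC.biUnion fun t _ ↦ t.countable_toSet, ?_⟩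
  rw [Subtype.dense_iff]
  refine fun x hx ↦ mem_closure_iff.2 fun U hU hxU ↦ ?_
  obtain ⟨_, ht, t, htC, rfl⟩ := mem_closure_iff.1 hSC _ (isOpen_hit hU)
    ⟨x, subset_closure hx, hxU⟩
  obtain ⟨_, ⟨z, hz, rfl⟩, hzU⟩ := (closure_inter_open_nonempty_iff hU).1 ht
  exact ⟨z, hzU, z, mem_biUnion htC hz, rfl⟩

theorem HasCountableTightness.hereditarilyLindelofSpace
    (h : HasCountableTightness (FellHyperspace X)) : HereditarilyLindelofSpace X := by
  refine ⟨fun S _ ↦ isLindelof_of_countable_subcover fun {ι} U hU hSU ↦ ?_⟩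
  obtain ⟨C, hC, hUC⟩ := h.exists_countable_mem_closure_image (tendsto_compl_biUnion_finset hU)
  refine ⟨⋃ t ∈ C, (t : Set ι), hC.biUnion fun t _ ↦ t.countable_toSet, fun x hx ↦ ?_⟩
  have hmiss : ofIsClosed (isOpen_iUnion hU).isClosed_compl ∈ miss {x} := by
    simpa using hSU hx
  obtain ⟨_, ht, t, htC, rfl⟩ := mem_closure_iff.1 hUC _ (isOpen_miss isCompact_singleton) hmiss
  obtain ⟨i, hi, hxi⟩ : ∃ i ∈ t, x ∈ U i := by simpa using ht
  exact mem_biUnion (mem_biUnion htC hi) hxi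

theorem IsHereditarilySeparableSpace.firstCountableTopology_fellHyperspace [R1Space X]
    [LocallyCompactSpace X] [HereditarilyLindelofSpace X] (h : IsHereditarilySeparableSpace X) :
    FirstCountableTopology (FellHyperspace X) := by
  have : FirstCountableTopology X := firstCountableTopology_of_hereditarilyLindelofSpace
  refine ⟨fun F ↦ ?_⟩
  have : SeparableSpace (F : Set X) := h F
  exact isCountablyGenerated_nhds (hasCountableOuterPiBase_of_separableSpace (F : Set X))
    (isHemicompact_of_isOpen F.isClosed.isOpen_compl)

theorem mainTheorem7_general [R1Space X] [LocallyCompactSpace X] :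
    List.TFAE [
      HasCountableTightness (FellHyperspace X),
      HasReznichenkoProperty (FellHyperspace X),
      HasPytkeevProperty (FellHyperspace X),
      IsHereditarilySeparableSpace X ∧ HereditarilyLindelofSpace X] := by
  tfae_have 3 → 2 := fun h ↦ h.hasReznichenkoProperty
  tfae_have 2 → 1 := fun h ↦ h.hasCountableTightness
  tfae_have 1 → 4 := fun h ↦ ⟨h.isHereditarilySeparableSpace, h.hereditarilyLindelofSpace⟩
  tfae_have 4 → 3 := fun ⟨hsep, _⟩ ↦
    have := hsep.firstCountableTopology_fellHyperspace
    hasPytkeevProperty_of_firstCountableTopology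
  tfae_finish

end FellCountability

theorem mainTheorem7 {X : Type*} [TopologicalSpace X] [T2Space X] [LocallyCompactSpace X] :
    List.TFAE [
      HasCountableTightness (FellHyperspace X),
      HasReznichenkoProperty (FellHyperspace X),
      HasPytkeevProperty (FellHyperspace X),
      IsHereditarilySeparableSpace X ∧ HereditarilyLindelofSpace X] :=
  mainTheorem7_general
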